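/- Let $P_k$ denote the path on $k$ vertices. A dissociation set of a finite simple graph $G$ is a set of vertices inducing a subgraph of maximum degree at most $1$, and a maximum dissociation set is a dissociation set of largest cardinality. For trees $T_1,\dots,T_r$, let $S^*_{T_1,\dots,T_r}$ denote a tree which is the union of induced subtrees isomorphic to $T_1,\dots,T_r$ that all have one common vertex $c$, where $c$ is a leaf of each of these subtrees and any two of them share no other vertex. **Theorem 4.5.** Let $m$ be a positive integer. Every tree $T$ on $3m$ vertices has at most $3^{m-1}+m+1$ maximum dissociation sets, and this bound is attained for every $m\ge 1$. Moreover, a tree $T$ on $3m$ vertices has exactly $3^{m-1}+m+1$ maximum dissociation sets if and only if $T\cong S^*_{P_3,T_1,\dots,T_{m-1}}$ with $T_i\cong P_4$ for all $1\le i\le m-1$ (for $m=1$ this is $T\cong P_3$). -/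

import Mathlib

namespace SimpleGraph

variable {V : Type*}

/-- A dissociation set of `G`: a set of vertices that induces a subgraph in which every vertex has
degree at most `1`. -/
def IsDissociationSet (G : SimpleGraph V) (S : Finset V) : Prop :=
  ∀ v : (S : Set V), ((G.induce (S : Set V)).neighborSet v).encard ≤ 1

/-- A maximum dissociation set: a dissociation set of the largest cardinality. -/
def IsMaximumDissociationSet (G : SimpleGraph V) (S : Finset V) : Prop :=
  G.IsDissociationSet S ∧ ∀ S' : Finset V, G.IsDissociationSet S' → S'.card ≤ S.card

/-- The number of maximum dissociation sets of `G` (for `V` finite). -/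
noncomputable def numMaximumDissociationSets (G : SimpleGraph V) : ℕ :=
  {S : Finset V | G.IsMaximumDissociationSet S}.ncard

/-- A leaf of a graph: a vertex with exactly one neighbour. -/
def IsLeaf (G : SimpleGraph V) (v : V) : Prop :=
  ∃! w, G.Adj v w

/-- `G` consists of induced copies of the graphs `T i` glued together at a common leaf `c`: the
copies cover the vertices and the edges of `G`, two different copies share no vertex except `c`,
and `c` is a leaf of every copy. For trees `T 1, …, T r` this is the tree `S^*_{T_1, …, T_r}`. -/
def IsLeafAmalgam (G : SimpleGraph V) {ι : Type*} {W : ι → Type*}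
    (T : ∀ i, SimpleGraph (W i)) : Prop :=
  ∃ (c : V) (φ : ∀ i, T i ↪g G),
    (∀ i, ∃ x, φ i x = c ∧ (T i).IsLeaf x) ∧
    (∀ i j, i ≠ j → ∀ x y, φ i x = φ j y → φ i x = c) ∧
    (∀ v, ∃ i x, φ i x = v) ∧
    (∀ u v, G.Adj u v → ∃ i x y, φ i x = u ∧ φ i y = v)

end SimpleGraph

/-! ### Maximum dissociation sets as choices of one deleted vertex per packed path -/

namespace SimpleGraph

/-! A set is a dissociation set exactly when its complement meets every path on three vertices,
induced or not. In a forest, the largest number `k` of disjoint such paths equals the least size of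
a set meeting all of them (`IsAcyclic.exists_packing_and_cover`). So the complement of a maximum
dissociation set picks exactly one vertex from each packed path, or row, and there are at most `3 ^
k` of them. If `k < m`, this is at most `3 ^ (m - 1)`, below the bound.

If `k = m`, the rows partition the vertices and induction on the number of rows applies
(`card_coveringChoices_le`). Remove a row that does not disconnect the others, joined to them by an
edge ending at `v`. A choice on the other rows extends in at most three ways if it deletes `v`, in
at most two if it keeps `v` but isolates it, and in at most one otherwise. With `X` choices through
`v` and `Y` isolating it, the count grows by at most `2 * X + Y`, which is at most `2 * 3 ^ (m - 2)
+ 1` for `m - 1` remaining rows (`two_mul_card_through_add_card_isolating_le`). Equality forces `v`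
to be an end of its row with a neighbour in every other row. Peeling each of these rows in turn
shows that they too are attached by ends, which determines the tree. -/

theorem isDissociationSet_iff {V : Type*} (G : SimpleGraph V) (S : Finset V) :
    G.IsDissociationSet S ↔
      ∀ x ∈ S, ∀ y ∈ S, ∀ z ∈ S, G.Adj x y → G.Adj x z → y = z := by
  unfold IsDissociationSet
  simp only [Set.encard_le_one_iff]
  constructor
  · intro h x hx y hy z hz hxy hxz
    have := h ⟨x, hx⟩ ⟨y, hy⟩ ⟨z, hz⟩ hxy hxz
    exact congrArg Subtype.val this
  · intro h x y z hxy hxz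
    exact Subtype.ext (h x x.2 y y.2 z z.2 hxy hxz)

/-- The rows of `ι × Fin 3` are paths on three vertices. -/
def HasPathRows {ι : Type*} (H : SimpleGraph (ι × Fin 3)) : Prop :=
  ∀ i, H.Adj (i, 0) (i, 1) ∧ H.Adj (i, 1) (i, 2)

/-- Deleting the vertex `(i, f i)` from every row `i` leaves a dissociation set. -/
def IsCoveringChoice {ι : Type*} (H : SimpleGraph (ι × Fin 3)) (f : ι → Fin 3) : Prop :=
  ∀ x y z : ι × Fin 3, x.2 ≠ f x.1 → y.2 ≠ f y.1 → z.2 ≠ f z.1 → H.Adj x y → H.Adj x z → y = z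

open Classical in
/-- The choices of one vertex per row whose deletion leaves a dissociation set. -/
noncomputable def coveringChoices {ι : Type*} [Fintype ι] (H : SimpleGraph (ι × Fin 3)) :
    Finset (ι → Fin 3) :=
  Finset.univ.filter H.IsCoveringChoice

theorem mem_coveringChoices {ι : Type*} [Fintype ι] {H : SimpleGraph (ι × Fin 3)} {f : ι → Fin 3} :
    f ∈ H.coveringChoices ↔ H.IsCoveringChoice f := by
  simp [coveringChoices]

theorem IsDissociationSet.exists_not_mem_row {ι V : Type*} {G : SimpleGraph V} {S : Finset V}
    (hS : G.IsDissociationSet S) {p : ι × Fin 3 → V} (hp : Function.Injective p)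
    (hrow : (G.comap p).HasPathRows) (i : ι) : ∃ a, p (i, a) ∉ S := by
  by_contra! h
  have := (isDissociationSet_iff G S).1 hS _ (h 1) _ (h 0) _ (h 2) (hrow i).1.symm (hrow i).2
  simpa using hp this

/-- The complement of a maximum set has at most as many vertices as there are rows, because of `D`,
yet it meets every row. Hence it is exactly one vertex per row, and these vertices determine the
set. -/
theorem numMaximumDissociationSets_le {ι V : Type*} [Fintype ι] [Fintype V] {G : SimpleGraph V}
    {p : ι × Fin 3 → V} (hp : Function.Injective p) (hrow : (G.comap p).HasPathRows)
    {D : Finset V} (hD : G.IsDissociationSet D) (hcard : Fintype.card V ≤ D.card + Fintype.card ι) :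
    G.numMaximumDissociationSets ≤ (G.comap p).coveringChoices.card := by
  classical
  choose! F hF using fun (S : Finset V) (hS : G.IsDissociationSet S) (i : ι) =>
    hS.exists_not_mem_row hp hrow i
  have key : ∀ S, G.IsMaximumDissociationSet S →
      Sᶜ = Finset.univ.image fun i => p (i, F S i) := by
    intro S hS
    symm
    apply Finset.eq_of_subset_of_card_le
    · intro x hx
      obtain ⟨i, -, rfl⟩ := Finset.mem_image.1 hx
      simpa using hF S hS.1 i
    · rw [Finset.card_image_of_injective _ fun i j h => congrArg Prod.fst (hp h),
        Finset.card_univ, Finset.card_compl]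
      have := hS.2 D hD
      omega
  unfold numMaximumDissociationSets
  rw [← Set.ncard_coe_finset]
  refine Set.ncard_le_ncard_of_injOn F ?_ ?_ (Set.toFinite _)
  · intro S hS
    simp only [Finset.mem_coe, mem_coveringChoices]
    have hmem : ∀ x : ι × Fin 3, x.2 ≠ F S x.1 → p x ∈ S := by
      intro x hx
      by_contra h
      have := key S hS ▸ Finset.mem_compl.2 h
      obtain ⟨i, -, hi⟩ := Finset.mem_image.1 this
      have := hp hi
      subst this
      exact hx rfl
    intro x y z hx hy hz hxy hxz
    exact hp ((isDissociationSet_iff G S).1 hS.1 _ (hmem x hx) _ (hmem y hy) _ (hmem z hz) hxy hxz)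
  · intro S hS S' hS' h
    have h1 := key S hS
    rw [h, ← key S' hS'] at h1
    simpa using h1

/-- Here the rows are all of the vertices. Every dissociation set misses a vertex of each row, so
one that misses exactly one per row is maximum. -/
theorem card_coveringChoices_le_numMaximumDissociationSets {ι : Type*} [Fintype ι]
    {H : SimpleGraph (ι × Fin 3)} (hrow : H.HasPathRows) :
    H.coveringChoices.card ≤ H.numMaximumDissociationSets := by
  classical
  unfold numMaximumDissociationSets
  rw [← Set.ncard_coe_finset]
  have hle : ∀ f : ι → Fin 3, (Finset.univ.image fun i => (i, f i)).card = Fintype.card ι := by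
    intro f
    rw [Finset.card_image_of_injective _ fun i j h => congrArg Prod.fst h, Finset.card_univ]
  refine Set.ncard_le_ncard_of_injOn (fun f => (Finset.univ.image fun i => (i, f i))ᶜ) ?_ ?_
    (Set.toFinite _)
  · intro f hf
    simp only [Finset.mem_coe, mem_coveringChoices] at hf
    have hmem : ∀ x : ι × Fin 3, x ∈ (Finset.univ.image fun i => (i, f i))ᶜ → x.2 ≠ f x.1 := by
      intro x hx h
      apply Finset.mem_compl.1 hx
      exact Finset.mem_image.2 ⟨x.1, Finset.mem_univ _, Prod.ext rfl h.symm⟩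
    refine ⟨(isDissociationSet_iff _ _).2 ?_, ?_⟩
    · intro x hx y hy z hz hxy hxz
      exact hf x y z (hmem x hx) (hmem y hy) (hmem z hz) hxy hxz
    · intro S hS
      choose F hF using fun i => hS.exists_not_mem_row (p := id) Function.injective_id hrow i
      have : Finset.univ.image (fun i => (i, F i)) ⊆ Sᶜ := by
        intro x hx
        obtain ⟨i, -, rfl⟩ := Finset.mem_image.1 hx
        simpa using hF i
      have := Finset.card_le_card this
      rw [hle, Finset.card_compl] at this
      have h2 := Finset.card_le_univ S
      rw [Finset.card_compl, hle]
      have h3 := Fintype.card_prod ι (Fin 3)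
      rw [Fintype.card_fin] at h3
      omega
  · intro f _ g _ h
    simp only [compl_inj_iff] at h
    ext1 i
    have : (i, f i) ∈ Finset.univ.image fun i => (i, g i) :=
      h ▸ Finset.mem_image_of_mem _ (Finset.mem_univ i)
    obtain ⟨j, -, hj⟩ := Finset.mem_image.1 this
    obtain ⟨rfl, hj⟩ := Prod.mk.inj hj
    exact hj.symm

theorem IsDissociationSet.map_iso {V W : Type*} {G : SimpleGraph V} {H : SimpleGraph W}
    (e : G ≃g H) {S : Finset V} (hS : G.IsDissociationSet S) :
    H.IsDissociationSet (S.map e.toEquiv.toEmbedding) := by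
  rw [isDissociationSet_iff] at hS ⊢
  simp only [Finset.mem_map, forall_exists_index, and_imp, forall_apply_eq_imp_iff₂]
  intro x hx y hy z hz hxy hxz
  exact congrArg _ (hS x hx y hy z hz (e.map_adj_iff.1 hxy) (e.map_adj_iff.1 hxz))

theorem IsMaximumDissociationSet.map_iso {V W : Type*} {G : SimpleGraph V} {H : SimpleGraph W}
    (e : G ≃g H) {S : Finset V} (hS : G.IsMaximumDissociationSet S) :
    H.IsMaximumDissociationSet (S.map e.toEquiv.toEmbedding) := by
  refine ⟨hS.1.map_iso e, fun S' hS' => ?_⟩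
  have := hS.2 _ (hS'.map_iso e.symm)
  simpa using this

theorem numMaximumDissociationSets_congr {V W : Type*} [Finite V] {G : SimpleGraph V}
    {H : SimpleGraph W} (e : G ≃g H) :
    G.numMaximumDissociationSets = H.numMaximumDissociationSets := by
  have := Finite.of_equiv V e.toEquiv
  apply le_antisymm
  · exact Set.ncard_le_ncard_of_injOn _ (fun S hS => IsMaximumDissociationSet.map_iso e hS)
      (Finset.map_injective _).injOn (Set.toFinite _)
  · exact Set.ncard_le_ncard_of_injOn _ (fun S hS => IsMaximumDissociationSet.map_iso e.symm hS)
      (Finset.map_injective _).injOn (Set.toFinite _)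

end SimpleGraph

/-! ### Packing and covering paths on three vertices in a forest -/

namespace SimpleGraph

/-- In an acyclic graph, two neighbours of `x` joined by a walk avoiding `x` are equal. -/
theorem IsAcyclic.eq_of_adj_of_reflTransGen {V : Type*} {G : SimpleGraph V} (hG : G.IsAcyclic)
    {x y z : V} (hxy : G.Adj x y) (hxz : G.Adj x z)
    (h : Relation.ReflTransGen (fun u w => G.Adj u w ∧ u ≠ x ∧ w ≠ x) y z) : y = z := by
  by_contra hne
  -- The edge `xy` is a bridge, but the edge `xz` followed by the walk from `z` to `y` avoiding `x`
  -- would bypass it.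
  have hb := isAcyclic_iff_forall_adj_isBridge.1 hG hxy
  rw [isBridge_iff] at hb
  apply hb
  have h1 : (G.deleteEdges {s(x, y)}).Reachable y z := by
    clear hne hxz
    induction h with
    | refl => exact Reachable.refl _
    | tail _ h ih =>
      refine ih.trans (Adj.reachable ?_)
      rw [deleteEdges_adj]
      refine ⟨h.1, ?_⟩
      rw [Set.mem_singleton_iff, Sym2.eq_iff]
      rintro (⟨h', -⟩ | ⟨-, h'⟩)
      · exact h.2.1 h'
      · exact h.2.2 h'
  refine (Adj.reachable ?_ : Reachable _ x z).trans h1.symm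
  rw [deleteEdges_adj]
  refine ⟨hxz, ?_⟩
  rw [Set.mem_singleton_iff, Sym2.eq_iff]
  rintro (⟨-, h'⟩ | ⟨h', -⟩)
  · exact hne h'.symm
  · exact hxy.ne h'

/-- In an acyclic graph, a set `D` that contains a path on three vertices and meets the rest of `U`
only at `x` can be shrunk until deleting its attaching vertex destroys all such paths. -/
theorem IsAcyclic.exists_pendant_set {V : Type*} {G : SimpleGraph V} (hG : G.IsAcyclic)
    (U : Finset V) (n : ℕ) : ∀ (D : Finset V) (x : V), D.card = n → D ⊆ U → x ∈ D →
    (∀ u ∈ D, u ≠ x → ∀ w ∈ U, G.Adj u w → w ∈ D) → ¬ G.IsDissociationSet D →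
    ∃ (D' : Finset V) (y : V), D' ⊆ U ∧ y ∈ D' ∧
      (∀ u ∈ D', u ≠ y → ∀ w ∈ U, G.Adj u w → w ∈ D') ∧ ¬ G.IsDissociationSet D' ∧
      ∀ a ∈ D', ∀ b ∈ D', ∀ c ∈ D', a ≠ y → b ≠ y → c ≠ y → G.Adj a b → G.Adj a c → b = c := by
  classical
  induction n using Nat.strong_induction_on with
  | _ n ih =>
    intro D x hn hDU hxD hclosed hD
    by_cases hmin : ∀ a ∈ D, ∀ b ∈ D, ∀ c ∈ D, a ≠ x → b ≠ x → c ≠ x →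
      G.Adj a b → G.Adj a c → b = c
    · exact ⟨D, x, hDU, hxD, hclosed, hD, hmin⟩
    push Not at hmin
    obtain ⟨a, ha, b, hb, c, hc, hax, hbx, hcx, hab, hac, hbc⟩ := hmin
    let r : V → V → Prop := fun u w => G.Adj u w ∧ u ≠ x ∧ w ≠ x
    have hsymm : ∀ u w, Relation.ReflTransGen r u w → Relation.ReflTransGen r w u := by
      intro u w h
      induction h with
      | refl => exact .refl
      | tail _ h ih => exact .head ⟨h.1.symm, h.2.2, h.2.1⟩ ih
    -- The part of `D` reachable from `a` without passing through `x`. It still contains the path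
    -- `b`, `a`, `c`, and its only possible exit within `U` is `x`.
    let K : Finset V := D.filter fun w => w ≠ x ∧ Relation.ReflTransGen r a w
    have hK : ∀ {w}, w ∈ K ↔ w ∈ D ∧ w ≠ x ∧ Relation.ReflTransGen r a w := by
      intro w; simp [K]
    have haK : a ∈ K := hK.2 ⟨ha, hax, .refl⟩
    have hbK : b ∈ K := hK.2 ⟨hb, hbx, .single ⟨hab, hax, hbx⟩⟩
    have hcK : c ∈ K := hK.2 ⟨hc, hcx, .single ⟨hac, hax, hcx⟩⟩
    have hlt : K.card < n := by
      rw [← hn]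
      refine Finset.card_lt_card ⟨Finset.filter_subset _ _, fun h => (hK.1 (h hxD)).2.1 rfl⟩
    have hKd : ¬ G.IsDissociationSet K := fun h =>
      hbc ((isDissociationSet_iff G K).1 h a haK b hbK c hcK hab hac)
    have hstep : ∀ u ∈ K, ∀ w ∈ U, G.Adj u w → w ≠ x → w ∈ K := by
      intro u hu w hw huw hwx
      obtain ⟨h1, h2, h3⟩ := hK.1 hu
      exact hK.2 ⟨hclosed u h1 h2 w hw huw, hwx, h3.tail ⟨huw, h2, hwx⟩⟩
    -- By acyclicity `x` has at most one neighbour in `K`. It becomes the new attaching vertex; if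
    -- there is none, any vertex of `K` serves.
    by_cases hy : ∃ y ∈ K, G.Adj x y
    · obtain ⟨y, hyK, hxy⟩ := hy
      refine ih _ hlt K y rfl ((Finset.filter_subset _ _).trans hDU) hyK ?_ hKd
      intro u hu huy w hw huw
      refine hstep u hu w hw huw ?_
      rintro rfl
      refine huy (hG.eq_of_adj_of_reflTransGen huw.symm hxy ?_)
      exact (hsymm _ _ (hK.1 hu).2.2).trans (hK.1 hyK).2.2
    · push Not at hy
      refine ih _ hlt K a rfl ((Finset.filter_subset _ _).trans hDU) haK ?_ hKd
      intro u hu _ w hw huw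
      refine hstep u hu w hw huw ?_
      rintro rfl
      exact hy u hu huw.symm

/-- In an acyclic graph, a largest packing by disjoint paths on three vertices and a smallest set
of vertices meeting all such paths have the same size. -/
theorem IsAcyclic.exists_packing_and_cover {V : Type*} [DecidableEq V] {G : SimpleGraph V}
    (hG : G.IsAcyclic) (n : ℕ) : ∀ U : Finset V, U.card = n →
    ∃ (k : ℕ) (p : Fin k × Fin 3 → V) (C : Finset V), Function.Injective p ∧ (∀ x, p x ∈ U) ∧
      (G.comap p).HasPathRows ∧ C.card ≤ k ∧ G.IsDissociationSet (U \ C) := by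
  induction n using Nat.strong_induction_on with
  | _ n ih =>
    intro U hn
    by_cases hU : G.IsDissociationSet U
    · exact ⟨0, fun x => x.1.elim0, ∅, fun x => x.1.elim0, fun x => x.1.elim0,
        fun i => i.elim0, by simp, by simpa using hU⟩
    have hne : U.Nonempty := by
      rw [Finset.nonempty_iff_ne_empty]
      rintro rfl
      exact hU ((isDissociationSet_iff _ _).2 (by simp))
    obtain ⟨x, hx⟩ := hne
    obtain ⟨D, y, hDU, hyD, hclosed, hD, hmin⟩ := hG.exists_pendant_set U _ U x rfl le_rfl hx
      (fun u _ _ w hw _ => hw) hU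
    obtain ⟨k, p, C, hp, hpU, hrow, hCk, hC⟩ := ih (U \ D).card (by
      rw [← hn]
      exact Finset.card_lt_card ⟨Finset.sdiff_subset, fun h =>
        (Finset.mem_sdiff.1 (h (hDU hyD))).2 hyD⟩) (U \ D) rfl
    rw [isDissociationSet_iff] at hD
    push Not at hD
    obtain ⟨a, ha, b, hb, c, hc, hab, hac, hbc⟩ := hD
    have hq : Function.Injective ![b, a, c] := by
      simp [Function.Injective, Fin.forall_fin_succ, hab.ne, hab.ne', hac.ne, hac.ne', hbc,
        Ne.symm hbc]
    have hqD : ∀ i, ![b, a, c] i ∈ D := by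
      intro i
      fin_cases i <;> assumption
    -- The new row lies inside `D`, with the centre `a` at index `1`. The single vertex `y` both
    -- destroys all the paths in `D` and cuts `D` off from the rest of `U`.
    refine ⟨k + 1, fun x => Fin.cases ![b, a, c] (fun i a => p (i, a)) x.1 x.2, insert y C,
      ?_, ?_, ?_, (Finset.card_insert_le _ _).trans (by omega), ?_⟩
    · rintro ⟨i, s⟩ ⟨j, t⟩ h
      cases i using Fin.cases with
      | zero =>
        cases j using Fin.cases with
        | zero => rw [hq h]
        | succ j =>
          have h1 := hqD s
          have h2 := hpU (j, t)
          simp only [Fin.cases_zero, Fin.cases_succ] at h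
          rw [← h] at h2
          exact absurd h1 (Finset.mem_sdiff.1 h2).2
      | succ i =>
        cases j using Fin.cases with
        | zero =>
          have h1 := hqD t
          have h2 := hpU (i, s)
          simp only [Fin.cases_zero, Fin.cases_succ] at h
          rw [h] at h2
          exact absurd h1 (Finset.mem_sdiff.1 h2).2
        | succ j =>
          have := hp h
          simp_all
    · rintro ⟨i, s⟩
      cases i using Fin.cases with
      | zero => exact hDU (hqD s)
      | succ i => exact (Finset.mem_sdiff.1 (hpU (i, s))).1
    · intro i
      cases i using Fin.cases with
      | zero => exact ⟨hab.symm, hac⟩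
      | succ i => exact hrow i
    · rw [isDissociationSet_iff] at hC ⊢
      have hadj : ∀ u ∈ U \ insert y C, ∀ w ∈ U \ insert y C, G.Adj u w → (u ∈ D ↔ w ∈ D) := by
        intro u hu w hw huw
        simp only [Finset.mem_sdiff, Finset.mem_insert, not_or] at hu hw
        exact ⟨fun h => hclosed u h hu.2.1 w hw.1 huw, fun h => hclosed w h hw.2.1 u hu.1 huw.symm⟩
      intro u hu v hv w hw huv huw
      have h1 := hadj u hu v hv huv
      have h2 := hadj u hu w hw huw
      simp only [Finset.mem_sdiff, Finset.mem_insert, not_or] at hu hv hw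
      by_cases h : u ∈ D
      · exact hmin u h v (h1.1 h) w (h2.1 h) hu.2.1 hv.2.1 hw.2.1 huv huw
      · have h3 := mt h1.2 h
        have h4 := mt h2.2 h
        exact hC u (by simp [*]) v (by simp [*]) w (by simp [*]) huv huw

end SimpleGraph

/-! ### Counting covering choices under local constraints -/

namespace SimpleGraph

theorem card_filter_forall_mem_eq {ι : Type*} [Fintype ι] [DecidableEq ι] (s : Finset ι)
    (g : ι → Fin 3) :
    (Finset.univ.filter fun f : ι → Fin 3 => ∀ i ∈ s, f i = g i).card
      = 3 ^ (Fintype.card ι - s.card) := by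
  have : (Finset.univ.filter fun f : ι → Fin 3 => ∀ i ∈ s, f i = g i)
      = Fintype.piFinset fun i => if i ∈ s then {g i} else Finset.univ := by
    ext f
    simp only [Finset.mem_filter, Finset.mem_univ, true_and, Fintype.mem_piFinset]
    refine forall_congr' fun i => ?_
    by_cases h : i ∈ s <;> simp [h]
  rw [this, Fintype.card_piFinset, ← Finset.card_compl, ← Finset.prod_const,
    ← Finset.prod_subset (Finset.subset_univ sᶜ)]
  · refine Finset.prod_congr rfl fun i hi => ?_
    rw [if_neg (Finset.mem_compl.1 hi)]
    simp
  · intro i _ hi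
    rw [if_pos (by simpa using hi)]
    simp

theorem card_le_of_forall_mem_eq {ι : Type*} [Fintype ι] {S : Finset (ι → Fin 3)}
    (s : Finset ι) (g : ι → Fin 3) (h : ∀ f ∈ S, ∀ i ∈ s, f i = g i) :
    S.card ≤ 3 ^ (Fintype.card ι - s.card) := by
  classical
  rw [← card_filter_forall_mem_eq s g]
  exact Finset.card_le_card fun f hf => by simpa using h f hf

theorem card_le_of_forall_eq {ι : Type*} [Fintype ι] {S : Finset (ι → Fin 3)} {i : ι} {a : Fin 3}
    (h : ∀ f ∈ S, f i = a) : S.card ≤ 3 ^ (Fintype.card ι - 1) :=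
  card_le_of_forall_mem_eq {i} (fun _ => a) (by simpa using h)

theorem card_le_of_forall_eq_and_eq {ι : Type*} [Fintype ι] {S : Finset (ι → Fin 3)} {i j : ι}
    (hij : i ≠ j) {a b : Fin 3} (h : ∀ f ∈ S, f i = a ∧ f j = b) :
    S.card ≤ 3 ^ (Fintype.card ι - 2) := by
  classical
  have := card_le_of_forall_mem_eq (S := S) {i, j} (fun l => if l = i then a else b) (by
    simp only [Finset.mem_insert, Finset.mem_singleton, forall_eq_or_imp, forall_eq, if_true,
      if_neg hij.symm]
    exact h)
  rwa [Finset.card_pair hij] at this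

theorem card_le_of_forall_mem_pair {ι : Type*} [Fintype ι] {S : Finset (ι → Fin 3)} {t i j : ι}
    (hti : t ≠ i) (htj : t ≠ j) (hij : i ≠ j) {e : Fin 3} (P : Finset (Fin 3 × Fin 3))
    (h : ∀ f ∈ S, f t = e ∧ (f i, f j) ∈ P) :
    S.card ≤ P.card * 3 ^ (Fintype.card ι - 3) := by
  classical
  have hS : S ⊆ P.biUnion fun q => S.filter fun f => (f i, f j) = q := by
    intro f hf
    simp only [Finset.mem_biUnion, Finset.mem_filter]
    exact ⟨_, (h f hf).2, hf, rfl⟩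
  refine (Finset.card_le_card hS).trans (Finset.card_biUnion_le_card_mul _ _ _ fun q _ => ?_)
  have hcard : ({t, i, j} : Finset ι).card = 3 := Finset.card_eq_three.2 ⟨t, i, j, hti, htj, hij, rfl⟩
  refine (card_le_of_forall_mem_eq {t, i, j}
    (fun l => if l = t then e else if l = i then q.1 else q.2) fun f hf => ?_).trans_eq (by rw [hcard])
  rw [Finset.mem_filter] at hf
  simp [hti.symm, htj.symm, hij.symm, (h f hf.1).1, ← hf.2]

variable {ι : Type*} {H : SimpleGraph (ι × Fin 3)}

theorem HasPathRows.adj (h : H.HasPathRows) (i : ι) {a b : Fin 3} (hab : a ≠ b)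
    (h1 : a = 1 ∨ b = 1) : H.Adj (i, a) (i, b) := by
  obtain ⟨h01, h12⟩ := h i
  have h10 := h01.symm
  have h21 := h12.symm
  fin_cases a <;> fin_cases b <;> simp_all

/-- A surviving vertex with a surviving neighbour in another row must lose all its neighbours along
its own row. Only one vertex per row is deleted, so a middle vertex cannot lose both ends, and an
end must lose the middle. -/
theorem IsCoveringChoice.eq_one_of_adj (hrow : H.HasPathRows) {f : ι → Fin 3}
    (hf : H.IsCoveringChoice f) {i : ι} {a : Fin 3} {y : ι × Fin 3} (hi : f i ≠ a)
    (hy : f y.1 ≠ y.2) (hne : i ≠ y.1) (hadj : H.Adj (i, a) y) : f i = 1 ∧ a ≠ 1 := by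
  have key : ∀ b, b ≠ a → (a = 1 ∨ b = 1) → f i = b := by
    intro b hb h1
    by_contra h
    have := hf (i, a) (i, b) y (Ne.symm hi) (Ne.symm h) (Ne.symm hy)
      (hrow.adj i hb.symm h1) hadj
    exact hne (congrArg Prod.fst this)
  by_cases ha : a = 1
  · subst ha
    have h0 := key 0 (by decide) (.inl rfl)
    have h2 := key 2 (by decide) (.inl rfl)
    rw [h0] at h2
    exact absurd h2 (by decide)
  · exact ⟨key 1 (Ne.symm ha) (.inr rfl), ha⟩

/-- The graph on the rows in which two rows are adjacent if an edge joins them. -/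
def rowGraph (H : SimpleGraph (ι × Fin 3)) : SimpleGraph ι where
  Adj i j := i ≠ j ∧ ∃ a b, H.Adj (i, a) (j, b)
  symm := ⟨fun _ _ ⟨h, a, b, hab⟩ => ⟨h.symm, b, a, hab.symm⟩⟩
  loopless := ⟨fun _ h => h.1 rfl⟩

open Classical in
/-- The covering choices that choose `v`. -/
noncomputable def coveringChoicesThrough [Fintype ι] (H : SimpleGraph (ι × Fin 3))
    (v : ι × Fin 3) : Finset (ι → Fin 3) :=
  H.coveringChoices.filter fun f => f v.1 = v.2

open Classical in
/-- The covering choices that leave `v` as an isolated vertex. -/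
noncomputable def coveringChoicesIsolating [Fintype ι] (H : SimpleGraph (ι × Fin 3))
    (v : ι × Fin 3) : Finset (ι → Fin 3) :=
  H.coveringChoices.filter fun f => f v.1 ≠ v.2 ∧ ∀ y : ι × Fin 3, H.Adj v y → f y.1 = y.2

theorem card_coveringChoicesThrough_le [Fintype ι] (v : ι × Fin 3) :
    (H.coveringChoicesThrough v).card ≤ 3 ^ (Fintype.card ι - 1) :=
  card_le_of_forall_eq fun _ hf => (Finset.mem_filter.1 hf).2

/-- This bounds the growth of the count when a row is attached at `v`. The first family has at most
`3 ^ (Fintype.card ι - 1)` members, so the bound is reached only if the second contributes. If `v`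
is an end with a neighbour in every other row, isolating `v` fixes the whole choice, which gives the
`+ 1`. A row without a neighbour of `v` makes the inequality strict. -/
theorem two_mul_card_through_add_card_isolating_le [Fintype ι] (hrow : H.HasPathRows)
    (hconn : H.rowGraph.Connected) (v : ι × Fin 3) :
    2 * (H.coveringChoicesThrough v).card + (H.coveringChoicesIsolating v).card
      ≤ 2 * 3 ^ (Fintype.card ι - 1) + 1 ∧
    (2 * (H.coveringChoicesThrough v).card + (H.coveringChoicesIsolating v).card
      = 2 * 3 ^ (Fintype.card ι - 1) + 1 →
      v.2 ≠ 1 ∧ ∀ j, j ≠ v.1 → ∃ a, H.Adj v (j, a)) := by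
  classical
  obtain ⟨t, e⟩ := v
  have hX := card_coveringChoicesThrough_le (H := H) (t, e)
  set X := H.coveringChoicesThrough (t, e) with hXdef
  set Y := H.coveringChoicesIsolating (t, e) with hYdef
  have memX : ∀ {f}, f ∈ X → H.IsCoveringChoice f ∧ f t = e := by
    intro f hf
    obtain ⟨h1, h2⟩ := Finset.mem_filter.1 hf
    exact ⟨mem_coveringChoices.1 h1, h2⟩
  have memY : ∀ {f}, f ∈ Y →
      H.IsCoveringChoice f ∧ f t ≠ e ∧ ∀ y : ι × Fin 3, H.Adj (t, e) y → f y.1 = y.2 := by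
    intro f hf
    obtain ⟨h1, h2⟩ := Finset.mem_filter.1 hf
    exact ⟨mem_coveringChoices.1 h1, h2⟩
  by_cases he : e = 1
  · subst he
    -- Isolating a middle vertex would delete both ends of its row.
    have : Y = ∅ := by
      rw [Finset.eq_empty_iff_forall_notMem]
      intro f hf
      have h0 := (memY hf).2.2 _ (hrow.adj t (b := 0) (by decide) (.inl rfl))
      have h2 := (memY hf).2.2 _ (hrow.adj t (b := 2) (by decide) (.inl rfl))
      exact absurd (h0.symm.trans h2) (by simp)
    rw [this, Finset.card_empty]
    exact ⟨by omega, fun h => by omega⟩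
  have hY1 : ∀ {f}, f ∈ Y → f t = 1 := fun hf =>
    (memY hf).2.2 (t, 1) (hrow.adj t he (.inr rfl))
  by_cases hA : ∀ j, j ≠ t → ∃ a, H.Adj (t, e) (j, a)
  · refine ⟨?_, fun _ => ⟨he, hA⟩⟩
    have : Y.card ≤ 1 := by
      refine Finset.card_le_one.2 fun f hf g hg => funext fun j => ?_
      by_cases hj : j = t
      · rw [hj, hY1 hf, hY1 hg]
      · obtain ⟨a, ha⟩ := hA j hj
        exact ((memY hf).2.2 _ ha).trans ((memY hg).2.2 _ ha).symm
    omega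
  suffices h : 2 * X.card + Y.card < 2 * 3 ^ (Fintype.card ι - 1) + 1 from
    ⟨h.le, fun h' => absurd h' h.ne⟩
  push Not at hA
  obtain ⟨j₀, hj₀, hadj₀⟩ := hA
  have hnt : Nontrivial ι := ⟨j₀, t, hj₀⟩
  have hcard : 1 < Fintype.card ι := Fintype.one_lt_card
  have hpow : 3 ^ (Fintype.card ι - 1) = 3 * 3 ^ (Fintype.card ι - 2) := by
    rw [← pow_succ']
    congr 1
    omega
  have hpos : 0 < 3 ^ (Fintype.card ι - 2) := by positivity
  -- If another vertex of row `t` has a neighbour outside the row, deleting `v` forces that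
  -- neighbour to be deleted. With `q = 3 ^ (Fintype.card ι - 2)` the sum is then at most `2 * q + 3
  -- * q`. Otherwise all edges leaving row `t` start at `v`, and the sum is at most `2 * (2 * q) +
  -- q`.
  by_cases hi : ∃ b j a, b ≠ e ∧ t ≠ j ∧ H.Adj (t, b) (j, a)
  · obtain ⟨b, j, a, hb, hj, hadj⟩ := hi
    have h1 : X.card ≤ 3 ^ (Fintype.card ι - 2) := by
      refine card_le_of_forall_eq_and_eq hj (a := e) (b := a) fun f hf => ⟨(memX hf).2, ?_⟩
      by_contra h
      have := (memX hf).1.eq_one_of_adj hrow (by rw [(memX hf).2]; exact hb.symm) h hj hadj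
      exact he ((memX hf).2.symm.trans this.1)
    have h2 : Y.card ≤ 3 ^ (Fintype.card ι - 1) := card_le_of_forall_eq fun f hf => hY1 hf
    omega
  push Not at hi
  obtain ⟨j₁, hne₁, b₁, a₁, hadj₁⟩ := hconn.preconnected.exists_adj_of_nontrivial t
  obtain rfl : b₁ = e := by
    by_contra hb
    exact hi b₁ j₁ a₁ hb hne₁ hadj₁
  obtain ⟨j₂, hne₂, b₂, a₂, hadj₂⟩ := hconn.preconnected.exists_adj_of_nontrivial j₀
  have hj₂ : t ≠ j₂ := by
    rintro rfl
    by_cases ha : a₂ = b₁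
    · subst ha
      exact hadj₀ _ hadj₂.symm
    · exact hi a₂ j₀ b₂ ha hj₀.symm hadj₂.symm
  have h2 : Y.card ≤ 3 ^ (Fintype.card ι - 2) :=
    card_le_of_forall_eq_and_eq hne₁ fun f hf => ⟨hY1 hf, (memY hf).2.2 _ hadj₁⟩
  -- The edge between rows `j₀` and `j₂` allows at most six of the nine pairs of deletions: one of
  -- its endpoints is deleted, or both rows lose their middle vertex.
  have h1 : X.card ≤ 6 * 3 ^ (Fintype.card ι - 3) := by
    have h6 : ∀ b a : Fin 3, (Finset.univ.filter fun q : Fin 3 × Fin 3 =>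
        q.1 = b ∨ q.2 = a ∨ q.1 = 1 ∧ q.2 = 1).card ≤ 6 := by decide
    refine (card_le_of_forall_mem_pair hj₀.symm hj₂ hne₂ (Finset.univ.filter fun q =>
      q.1 = b₂ ∨ q.2 = a₂ ∨ q.1 = 1 ∧ q.2 = 1) fun f hf => ⟨(memX hf).2, ?_⟩).trans
      (Nat.mul_le_mul_right _ (h6 b₂ a₂))
    simp only [Finset.mem_filter, Finset.mem_univ, true_and]
    by_contra! h
    have h3 := ((memX hf).1.eq_one_of_adj hrow h.1 h.2.1 hne₂ hadj₂).1
    have h4 := ((memX hf).1.eq_one_of_adj hrow h.2.1 h.1 hne₂.symm hadj₂.symm).1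
    exact h.2.2 h3 h4
  have h3 : 2 < Fintype.card ι := by
    have := Finset.card_le_univ ({t, j₀, j₂} : Finset ι)
    rw [Finset.card_eq_three.2 ⟨t, j₀, j₂, hj₀.symm, hj₂, hne₂, rfl⟩] at this
    omega
  have hpow' : 3 ^ (Fintype.card ι - 2) = 3 * 3 ^ (Fintype.card ι - 3) := by
    rw [← pow_succ']
    congr 1
    omega
  omega

end SimpleGraph

/-! ### Induction on the number of rows -/

namespace SimpleGraph

universe u

variable {ι : Type u} {H : SimpleGraph (ι × Fin 3)}

/-- The graph left after deleting row `i`. -/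
def deleteRow (H : SimpleGraph (ι × Fin 3)) (i : ι) :
    SimpleGraph (({i}ᶜ : Set ι) × Fin 3) :=
  H.comap fun x => (x.1.1, x.2)

theorem HasPathRows.deleteRow (hrow : H.HasPathRows) (i : ι) : (H.deleteRow i).HasPathRows :=
  fun j => hrow j

theorem rowGraph_deleteRow (i : ι) : (H.deleteRow i).rowGraph = H.rowGraph.induce {i}ᶜ := by
  ext j l
  simp [rowGraph, deleteRow, Subtype.ext_iff]

theorem IsCoveringChoice.deleteRow {f : ι → Fin 3} (hf : H.IsCoveringChoice f) (i : ι) :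
    (H.deleteRow i).IsCoveringChoice fun j => f j := by
  intro x y z hx hy hz hxy hxz
  have := hf (x.1, x.2) (y.1, y.2) (z.1, z.2) hx hy hz hxy hxz
  rw [Prod.ext_iff] at this ⊢
  exact ⟨Subtype.ext this.1, this.2⟩

/-- Restriction to the other rows is a map whose fibres embed in the three choices on row `i`. If
`v` survives, `eq_one_of_adj` leaves only the deletion of `a` or, when `a` is an end, of the middle.
The latter keeps the edge from `(i, a)` to `v`, so `v` may have no other surviving neighbour. -/
theorem card_coveringChoices_le_deleteRow [Fintype ι] (hrow : H.HasPathRows) (i : ι)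
    [Fintype ({i}ᶜ : Set ι)] {a : Fin 3} (v : ({i}ᶜ : Set ι) × Fin 3)
    (hadj : H.Adj (i, a) (v.1, v.2)) :
    H.coveringChoices.card ≤ (H.deleteRow i).coveringChoices.card
      + 2 * ((H.deleteRow i).coveringChoicesThrough v).card
      + (if a = 1 then 0 else ((H.deleteRow i).coveringChoicesIsolating v).card) := by
  classical
  let r : (ι → Fin 3) → (({i}ᶜ : Set ι) → Fin 3) := fun f j => f j
  have hmaps : ∀ f ∈ H.coveringChoices, r f ∈ (H.deleteRow i).coveringChoices := fun f hf =>
    mem_coveringChoices.2 ((mem_coveringChoices.1 hf).deleteRow i)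
  have hne : i ≠ v.1 := fun h => v.1.2 h.symm
  rw [Finset.card_eq_sum_card_fiberwise hmaps]
  have hbound : ∀ g ∈ (H.deleteRow i).coveringChoices,
      (H.coveringChoices.filter fun f => r f = g).card ≤ 1
        + (if g v.1 = v.2 then 2 else 0)
        + (if a = 1 then 0 else if g v.1 ≠ v.2 ∧
            ∀ y : ({i}ᶜ : Set ι) × Fin 3, (H.deleteRow i).Adj v y → g y.1 = y.2 then 1 else 0) := by
    intro g hg
    set F := H.coveringChoices.filter fun f => r f = g with hF
    have memF : ∀ {f}, f ∈ F → H.IsCoveringChoice f ∧ r f = g := by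
      intro f hf
      obtain ⟨h1, h2⟩ := Finset.mem_filter.1 hf
      exact ⟨mem_coveringChoices.1 h1, h2⟩
    have hinj : Set.InjOn (fun f : ι → Fin 3 => f i) F := by
      intro f hf f' hf' h
      ext1 j
      by_cases hj : j = i
      · subst hj; exact h
      · exact congrFun ((memF hf).2.trans (memF hf').2.symm) ⟨j, hj⟩
    have hle : ∀ A : Finset (Fin 3), (∀ f ∈ F, f i ∈ A) → F.card ≤ A.card := fun A hA =>
      Finset.card_le_card_of_injOn _ hA hinj
    by_cases h1 : g v.1 = v.2
    · rw [if_pos h1]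
      refine (hle Finset.univ fun _ _ => Finset.mem_univ _).trans ?_
      simp
    rw [if_neg h1]
    have hv : ∀ {f}, f ∈ F → f v.1 ≠ v.2 := fun hf h => h1 ((congrFun (memF hf).2 v.1).symm.trans h)
    have h2 : ∀ f ∈ F, f i ≠ a → f i = 1 ∧ a ≠ 1 := fun f hf h =>
      (memF hf).1.eq_one_of_adj hrow h (hv hf) hne hadj
    by_cases ha : a = 1
    · rw [if_pos ha]
      refine (hle {a} fun f hf => ?_).trans (by simp)
      rw [Finset.mem_singleton]
      by_contra h
      exact (h2 f hf h).2 ha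
    rw [if_neg ha]
    by_cases h3 : ∀ y : ({i}ᶜ : Set ι) × Fin 3, (H.deleteRow i).Adj v y → g y.1 = y.2
    · rw [if_pos ⟨h1, h3⟩]
      refine (hle {a, 1} fun f hf => ?_).trans Finset.card_le_two
      simp only [Finset.mem_insert, Finset.mem_singleton]
      by_cases h : f i = a
      · exact .inl h
      · exact .inr (h2 f hf h).1
    · rw [if_neg fun h => h3 h.2]
      push Not at h3
      obtain ⟨y, hvy, hgy⟩ := h3
      refine (hle {a} fun f hf => ?_).trans (by simp)
      rw [Finset.mem_singleton]
      by_contra h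
      have hy : f y.1 ≠ y.2 := fun h => hgy ((congrFun (memF hf).2 y.1).symm.trans h)
      have := (memF hf).1 (v.1, v.2) (i, a) (y.1, y.2) (hv hf).symm (Ne.symm h) hy.symm
        hadj.symm hvy
      exact y.1.2 (congrArg Prod.fst this).symm
  refine (Finset.sum_le_sum hbound).trans ?_
  rw [Finset.sum_add_distrib, Finset.sum_add_distrib]
  refine Nat.add_le_add (Nat.add_le_add ?_ ?_) ?_
  · simp
  · rw [coveringChoicesThrough, Finset.card_filter, Finset.mul_sum]
    refine Finset.sum_le_sum fun g _ => ?_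
    split_ifs <;> simp
  · split_ifs with ha
    · simp
    · rw [coveringChoicesIsolating, Finset.card_filter]

/-- A connected graph on `n` rows has at most `3 ^ (n - 1) + n + 1` covering choices, and equality
forces all rows to be attached by an end to the same end of one row. -/
theorem card_coveringChoices_le (n : ℕ) : ∀ {ι : Type u} [Fintype ι] {H : SimpleGraph (ι × Fin 3)},
    Fintype.card ι = n + 1 → H.HasPathRows → H.rowGraph.Connected →
    H.coveringChoices.card ≤ 3 ^ n + n + 2 ∧
    (H.coveringChoices.card = 3 ^ n + n + 2 →
      ∃ v : ι × Fin 3, v.2 ≠ 1 ∧ ∀ j, j ≠ v.1 → ∃ a, a ≠ 1 ∧ H.Adj v (j, a)) := by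
  classical
  induction n with
  | zero =>
    intro ι _ H hcard hrow hconn
    obtain ⟨t, ht⟩ := Fintype.card_eq_one_iff.1 hcard
    refine ⟨?_, fun _ => ⟨(t, 0), by simp, fun j hj => absurd (ht j) hj⟩⟩
    refine (Finset.card_le_univ _).trans ?_
    rw [Fintype.card_fun, hcard]
    simp
  | succ n ih =>
    intro ι _ H hcard hrow hconn
    have hcard' : ∀ i : ι, Fintype.card ({i}ᶜ : Set ι) = n + 1 := by
      intro i
      rw [Fintype.card_compl_set]
      simp [hcard]
    have hpow : 3 ^ (n + 1) = 3 * 3 ^ n := pow_succ' 3 n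
    have hpeel : ∀ (i : ι) (a : Fin 3) (v : ι × Fin 3), v.1 ≠ i → H.Adj (i, a) v →
        (H.rowGraph.induce {i}ᶜ).Connected →
        H.coveringChoices.card ≤ 3 ^ (n + 1) + (n + 1) + 2 ∧
        (H.coveringChoices.card = 3 ^ (n + 1) + (n + 1) + 2 →
          a ≠ 1 ∧ v.2 ≠ 1 ∧ ∀ j, j ≠ i → j ≠ v.1 → ∃ a, H.Adj v (j, a)) := by
      intro i a v hv hadj hc
      rw [← rowGraph_deleteRow] at hc
      have h1 := (ih (hcard' i) (hrow.deleteRow i) hc).1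
      have h2 := card_coveringChoices_le_deleteRow hrow i (a := a) (⟨v.1, hv⟩, v.2) hadj
      have h3 := two_mul_card_through_add_card_isolating_le (hrow.deleteRow i) hc (⟨v.1, hv⟩, v.2)
      rw [hcard' i, Nat.add_sub_cancel] at h3
      have h4 := card_coveringChoicesThrough_le (H := H.deleteRow i) (⟨v.1, hv⟩, v.2)
      rw [hcard' i, Nat.add_sub_cancel] at h4
      -- Attachment at a middle vertex loses the isolating term, so the bound is strict.
      by_cases ha : a = 1
      · rw [if_pos ha] at h2
        exact ⟨by omega, fun h => by omega⟩
      rw [if_neg ha] at h2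
      refine ⟨by omega, fun h => ?_⟩
      obtain ⟨h5, h6⟩ := h3.2 (by omega)
      refine ⟨ha, h5, fun j hj hjv => ?_⟩
      exact h6 ⟨j, hj⟩ fun h => hjv (congrArg Subtype.val h)
    have : Nontrivial ι := Fintype.one_lt_card_iff_nontrivial.1 (by omega)
    -- A connected row graph has a row whose removal leaves it connected.
    obtain ⟨i, hi⟩ := hconn.exists_connected_induce_compl_singleton_of_finite_nontrivial
    obtain ⟨j, hne, a, b, hadj⟩ := hconn.preconnected.exists_adj_of_nontrivial i
    obtain ⟨hle, heq⟩ := hpeel i a (j, b) hne.symm hadj hi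
    refine ⟨hle, fun h => ?_⟩
    obtain ⟨ha, hb, hstar⟩ := heq h
    have hstar' : ∀ l, l ≠ j → ∃ c, H.Adj (j, b) (l, c) := by
      intro l hl
      by_cases hli : l = i
      · exact ⟨a, hli ▸ hadj.symm⟩
      · exact hstar l hli hl
    refine ⟨(j, b), hb, fun l hl => ?_⟩
    obtain ⟨c, hc⟩ := hstar' l hl
    -- All rows are now attached to `(j, b)`, so any row `l ≠ j` can be peeled instead of `i`;
    -- equality again forces `c ≠ 1`.
    refine ⟨c, ((hpeel l c (j, b) (Ne.symm hl) hc.symm ?_).2 h).1, hc⟩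
    rw [connected_iff_exists_forall_reachable]
    refine ⟨⟨j, Ne.symm hl⟩, fun w => ?_⟩
    by_cases hw : w.1 = j
    · rw [show w = ⟨j, Ne.symm hl⟩ from Subtype.ext hw]
    · obtain ⟨d, hd⟩ := hstar' w.1 hw
      exact Adj.reachable ⟨Ne.symm hw, b, d, hd⟩

end SimpleGraph

/-! ### The extremal tree and its covering choices -/

namespace SimpleGraph

theorem Connected.rowGraph {ι : Type*} {H : SimpleGraph (ι × Fin 3)} (hH : H.Connected) :
    H.rowGraph.Connected := by
  have : Nonempty ι := hH.nonempty.map Prod.fst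
  refine ⟨fun i j => ?_⟩
  obtain ⟨w⟩ := hH.preconnected (i, 0) (j, 0)
  have key : ∀ {x y : ι × Fin 3}, H.Walk x y → H.rowGraph.Reachable x.1 y.1 := by
    intro x y w
    induction w with
    | nil => exact .refl _
    | @cons u v w h _ ih =>
      refine Reachable.trans ?_ ih
      by_cases huv : u.1 = v.1
      · rw [huv]
      · exact Adj.reachable ⟨huv, u.2, v.2, h⟩
  exact key w

/-- The parent of a vertex in the extremal tree rooted at `(none, 0)`. -/
def spiderParent {κ : Type*} : Option κ × Fin 3 → Option κ × Fin 3
  | (_, 0) => (none, 0)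
  | (i, 1) => (i, 0)
  | (i, 2) => (i, 1)

/-- The tree obtained from paths on three vertices, the rows of `Option κ × Fin 3`, by joining the
first vertex of row `none` to the first vertices of all other rows. -/
def spiderGraph (κ : Type*) : SimpleGraph (Option κ × Fin 3) :=
  fromRel fun x y => spiderParent x = y

section spiderGraph

variable {κ : Type*}

theorem spiderGraph_adj_spiderParent {x : Option κ × Fin 3} (hx : x ≠ (none, 0)) :
    (spiderGraph κ).Adj x (spiderParent x) := by
  refine ⟨?_, .inl rfl⟩
  obtain ⟨i, a⟩ := x
  fin_cases a
  · exact hx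
  · simp [spiderParent]
  · simp [spiderParent]

theorem spiderGraph_adj_iff {x y : Option κ × Fin 3} :
    (spiderGraph κ).Adj x y ↔
      x ≠ (none, 0) ∧ spiderParent x = y ∨ y ≠ (none, 0) ∧ spiderParent y = x := by
  constructor
  · rintro ⟨hne, rfl | rfl⟩
    · refine .inl ⟨?_, rfl⟩
      rintro rfl
      exact hne rfl
    · refine .inr ⟨?_, rfl⟩
      rintro rfl
      exact hne rfl
  · rintro (⟨h, rfl⟩ | ⟨h, rfl⟩)
    · exact spiderGraph_adj_spiderParent h
    · exact (spiderGraph_adj_spiderParent h).symm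

theorem spiderGraph_hasPathRows : (spiderGraph κ).HasPathRows := fun i =>
  ⟨(spiderGraph_adj_spiderParent (x := (i, 1)) (by simp)).symm,
    (spiderGraph_adj_spiderParent (x := (i, 2)) (by simp)).symm⟩

theorem spiderGraph_isTree [Finite κ] : (spiderGraph κ).IsTree := by
  have hconn : (spiderGraph κ).Connected := by
    rw [connected_iff_exists_forall_reachable]
    refine ⟨(none, 0), fun x => ?_⟩
    have hstep : ∀ x, (spiderGraph κ).Reachable (spiderParent x) x := by
      intro x
      by_cases hx : x = (none, 0)
      · subst hx; exact .refl _
      · exact (spiderGraph_adj_spiderParent hx).symm.reachable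
    obtain ⟨i, a⟩ := x
    have h0 := hstep (i, 0)
    have h1 := hstep (i, 1)
    have h2 := hstep (i, 2)
    fin_cases a
    · exact h0
    · exact h0.trans h1
    · exact (h0.trans h1).trans h2
  rw [isTree_iff_connected_and_card]
  refine ⟨hconn, le_antisymm ?_ hconn.card_vert_le_card_edgeSet_add_one⟩
  -- Every edge joins a vertex other than the root to its parent, so there are fewer edges than
  -- vertices.
  have hsub : (spiderGraph κ).edgeSet ⊆ (fun x => s(x, spiderParent x)) '' {(none, 0)}ᶜ := by
    intro e he
    induction e using Sym2.ind with
    | _ x y =>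
      rw [mem_edgeSet, spiderGraph_adj_iff] at he
      rcases he with ⟨h, rfl⟩ | ⟨h, rfl⟩
      · exact ⟨x, h, rfl⟩
      · exact ⟨y, h, Sym2.eq_swap⟩
  have h1 := (Set.ncard_le_ncard hsub (Set.toFinite _)).trans (Set.ncard_image_le (Set.toFinite _))
  have h2 := Set.ncard_add_ncard_compl {((none : Option κ), (0 : Fin 3))}
  rw [Set.ncard_singleton] at h2
  rw [Nat.card_coe_set_eq]
  omega

/-- A bijection from the extremal tree to a tree that preserves edges is an isomorphism. -/
theorem IsTree.nonempty_spiderGraph_iso [Finite κ] {V : Type*} {G : SimpleGraph V} (hG : G.IsTree)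
    (ψ : Option κ × Fin 3 → V) (hψ : Function.Bijective ψ)
    (hadj : ∀ x, x ≠ (none, 0) → G.Adj (ψ x) (ψ (spiderParent x))) :
    Nonempty (spiderGraph κ ≃g G) := by
  let e := Iso.comap (Equiv.ofBijective ψ hψ) G
  have hle : spiderGraph κ ≤ G.comap ψ := by
    intro x y h
    rcases spiderGraph_adj_iff.1 h with ⟨hx, rfl⟩ | ⟨hy, rfl⟩
    · exact hadj x hx
    · exact (hadj y hy).symm
  -- A tree is a minimal connected graph, so a connected spanning subgraph of it is all of it.
  have hge := (isTree_iff_minimal_connected.1 (e.isTree_iff.2 hG)).2 spiderGraph_isTree.connected hle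
  have heq : spiderGraph κ = G.comap ψ := le_antisymm hle hge
  rw [heq]
  exact ⟨e⟩

/-- Deleting the root separates the rows. If the root survives, each other row must delete its first
or second vertex, and the root tolerates one surviving neighbour: the next vertex of its own row
when `f none = 2`, or the first vertex of at most one other row when `f none = 1`. -/
theorem isCoveringChoice_spiderGraph {f : Option κ → Fin 3}
    (hf : f none = 0 ∨ (∀ j, f (some j) = 0 ∨ f (some j) = 1) ∧
      (∀ j l, f (some j) ≠ 0 → f (some l) ≠ 0 → j = l) ∧ (f none = 2 → ∀ j, f (some j) = 0)) :
    (spiderGraph κ).IsCoveringChoice f := by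
  have hnbr : ∀ {x y}, (spiderGraph κ).Adj x y → (x.2 = 2 → y = (x.1, 1)) ∧
      (x.2 = 1 → y = (x.1, 0) ∨ y = (x.1, 2)) ∧
      (x.2 = 0 → y = (x.1, 1) ∨ (∃ j, x.1 = some j ∧ y = (none, 0)) ∨
        x.1 = none ∧ ∃ j, y = (some j, 0)) := by
    rintro ⟨i, a⟩ ⟨j, b⟩ h
    rw [spiderGraph_adj_iff] at h
    fin_cases a <;> fin_cases b <;> cases i <;> cases j <;> simp_all [spiderParent]
  rintro ⟨i, a⟩ y z hx hy hz hxy hxz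
  have hy' := hnbr hxy
  have hz' := hnbr hxz
  fin_cases a
  · cases i with
    | none =>
      rcases hy'.2.2 rfl with rfl | ⟨_, h, _⟩ | ⟨-, j, rfl⟩
      · rcases hz'.2.2 rfl with rfl | ⟨_, h, _⟩ | ⟨-, l, rfl⟩
        · rfl
        · simp at h
        · simp only at hx hy hz
          rcases hf with hf | hf
          · exact absurd hf.symm hx
          · exact absurd (hf.2.2 (by simp at hx; omega) l).symm hz
      · simp at h
      · rcases hz'.2.2 rfl with rfl | ⟨_, h, _⟩ | ⟨-, l, rfl⟩
        · simp only at hx hy hz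
          rcases hf with hf | hf
          · exact absurd hf.symm hx
          · exact absurd (hf.2.2 (by simp at hx; omega) j).symm hy
        · simp at h
        · rcases hf with hf | hf
          · exact absurd hf.symm hx
          · rw [hf.2.1 j l hy.symm hz.symm]
    | some j =>
      have key : ¬ ((1 : Fin 3) ≠ f (some j) ∧ (0 : Fin 3) ≠ f none) := by
        rintro ⟨h1, h2⟩
        rcases hf with hf | hf
        · exact h2 hf.symm
        · rcases hf.1 j with h | h
          · exact hx h.symm
          · exact h1 h.symm
      rcases hy'.2.2 rfl with rfl | ⟨_, -, rfl⟩ | ⟨h, -⟩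
      · rcases hz'.2.2 rfl with rfl | ⟨_, -, rfl⟩ | ⟨h, -⟩
        · rfl
        · exact absurd ⟨hy, hz⟩ key
        · simp at h
      · rcases hz'.2.2 rfl with rfl | ⟨_, -, rfl⟩ | ⟨h, -⟩
        · exact absurd ⟨hz, hy⟩ key
        · rfl
        · simp at h
      · simp at h
  · rcases hy'.2.1 rfl with rfl | rfl <;> rcases hz'.2.1 rfl with rfl | rfl <;>
      simp at hx hy hz ⊢ <;> omega
  · rw [hy'.1 rfl, hz'.1 rfl]

theorem le_card_coveringChoices_spiderGraph [Fintype κ] :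
    3 ^ Fintype.card κ + Fintype.card κ + 2 ≤ (spiderGraph κ).coveringChoices.card := by
  classical
  -- The root deleted with free choices elsewhere gives `3 ^ Fintype.card κ`; the root kept with all
  -- other first vertices deleted gives two; the root kept with one neighbour in row `some j` gives
  -- `Fintype.card κ`.
  let F : (κ → Fin 3) ⊕ Option (Option κ) → Option κ → Fin 3
    | .inl g => fun i => i.elim 0 g
    | .inr none => fun i => i.elim 1 fun _ => 0
    | .inr (some none) => fun i => i.elim 2 fun _ => 0
    | .inr (some (some j)) => fun i => i.elim 1 fun l => if l = j then 1 else 0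
  have hF : Function.Injective F := by
    intro x y h
    have h0 := congrFun h none
    have h1 := fun j => congrFun h (some j)
    rcases x with g | _ | _ | j <;> rcases y with g' | _ | _ | l <;> simp [F] at h0 h1 ⊢
    · exact funext h1
    · simpa using h1 j
  have hcard : Fintype.card ((κ → Fin 3) ⊕ Option (Option κ))
      = 3 ^ Fintype.card κ + Fintype.card κ + 2 := by
    simp only [Fintype.card_sum, Fintype.card_fun, Fintype.card_fin, Fintype.card_option]
    ring
  rw [← hcard, ← Finset.card_univ]
  refine Finset.card_le_card_of_injOn F (fun x _ => mem_coveringChoices.2 ?_) hF.injOn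
  apply isCoveringChoice_spiderGraph
  rcases x with g | _ | _ | j
  · exact .inl rfl
  · exact .inr (by simp [F])
  · exact .inr (by simp [F])
  · refine .inr ⟨fun l => ?_, fun l l' => ?_, fun h => ?_⟩
    · by_cases h : l = j <;> simp [F, h]
    · by_cases h : l = j <;> by_cases h' : l' = j <;> simp [F, h, h']
    · simp [F] at h

end spiderGraph

end SimpleGraph

/-! ### The bound for trees and its equality case -/

namespace SimpleGraph

/-- The permutation of `Fin 3` reversing a path on three vertices if that moves `0` to `a`. -/
def endFlip (a : Fin 3) : Fin 3 ≃ Fin 3 :=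
  if a = 0 then Equiv.refl _ else Fin.revPerm

theorem endFlip_one (a : Fin 3) : endFlip a 1 = 1 := by
  revert a; decide

theorem endFlip_zero {a : Fin 3} (ha : a ≠ 1) : endFlip a 0 = a := by
  revert a; decide

/-- Send the row of `v` to `none` and flip each row so that its attaching end has index `0`; the
edges of the extremal tree then map to edges of `G`. -/
theorem IsTree.nonempty_spiderGraph_iso_of_attached {n : ℕ} {ι V : Type*} [Fintype ι]
    {G : SimpleGraph V} (hG : G.IsTree) (hι : Fintype.card ι = n + 1) {p : ι × Fin 3 → V}
    (hp : Function.Bijective p) (hrow : (G.comap p).HasPathRows) {v : ι × Fin 3} (hv : v.2 ≠ 1)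
    (hatt : ∀ j, j ≠ v.1 → ∃ a, a ≠ 1 ∧ G.Adj (p v) (p (j, a))) :
    Nonempty (spiderGraph (Fin n) ≃g G) := by
  classical
  obtain ⟨t, e⟩ := v
  let ε := Fintype.equivFinOfCardEq hι
  let σ : Option (Fin n) ≃ ι := (finSuccEquiv' (ε t)).symm.trans ε.symm
  have hσ : σ none = t := by simp [σ]
  have hσ' : ∀ j, σ (some j) ≠ t := fun j h => by simpa using σ.injective (h.trans hσ.symm)
  choose! c hc1 hc2 using hatt
  let d : Option (Fin n) → Fin 3 := fun i => i.elim e fun j => c (σ (some j))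
  have hd : ∀ i, d i ≠ 1 := by
    rintro (_ | j)
    · exact hv
    · exact hc1 _ (hσ' j)
  let τ : Option (Fin n) × Fin 3 ≃ ι × Fin 3 :=
    (Equiv.prodShear σ fun i => endFlip (d i))
  have hτ : ∀ i a, τ (i, a) = (σ i, endFlip (d i) a) := fun _ _ => rfl
  refine hG.nonempty_spiderGraph_iso (p ∘ τ) (hp.comp τ.bijective) ?_
  have hrow' : ∀ (i : ι) {a b : Fin 3}, a ≠ b → (a = 1 ∨ b = 1) → G.Adj (p (i, a)) (p (i, b)) :=
    fun i _ _ hab h1 => hrow.adj i hab h1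
  rintro ⟨i, a⟩ hx
  have h10 : endFlip (d i) 1 ≠ endFlip (d i) 0 := (endFlip (d i)).injective.ne (by decide)
  have h21 : endFlip (d i) 2 ≠ endFlip (d i) 1 := (endFlip (d i)).injective.ne (by decide)
  fin_cases a
  · cases i with
    | none => exact absurd rfl hx
    | some j =>
      have := hc2 _ (hσ' j)
      change G.Adj (p (τ (some j, 0))) (p (τ (none, 0)))
      rw [hτ, hτ, endFlip_zero (hd _), endFlip_zero (hd _), hσ]
      exact this.symm
  · exact hrow' _ h10 (.inl (endFlip_one _))
  · exact hrow' _ h21 (.inr (endFlip_one _))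

theorem IsTree.numMaximumDissociationSets_le {V : Type*} [Fintype V] {G : SimpleGraph V}
    (hG : G.IsTree) {n : ℕ} (hcard : Fintype.card V = 3 * (n + 1)) :
    G.numMaximumDissociationSets ≤ 3 ^ n + n + 2 ∧
      (G.numMaximumDissociationSets = 3 ^ n + n + 2 → Nonempty (spiderGraph (Fin n) ≃g G)) := by
  classical
  obtain ⟨k, p, C, hp, -, hrow, hCk, hC⟩ := hG.isAcyclic.exists_packing_and_cover _ Finset.univ rfl
  have hle := SimpleGraph.numMaximumDissociationSets_le hp hrow hC (by
    have := Finset.le_card_sdiff C Finset.univ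
    rw [Finset.card_univ] at this
    rw [Fintype.card_fin]
    omega)
  have hpc := Fintype.card_le_of_injective p hp
  rw [Fintype.card_prod, Fintype.card_fin, Fintype.card_fin, hcard] at hpc
  -- With at most `n` rows, the trivial count `3 ^ k` is already strictly below the bound. With `n +
  -- 1` rows, the packing exhausts the vertices.
  rcases (show k ≤ n + 1 by omega).lt_or_eq with hk | rfl
  · have h1 : (G.comap p).coveringChoices.card ≤ 3 ^ k := by
      refine (Finset.card_le_univ _).trans ?_
      simp
    have h2 : 3 ^ k ≤ 3 ^ n := Nat.pow_le_pow_right (by norm_num) (by omega)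
    exact ⟨by omega, fun h => by omega⟩
  · have hpb : Function.Bijective p := by
      rw [Fintype.bijective_iff_injective_and_card]
      refine ⟨hp, ?_⟩
      rw [Fintype.card_prod, Fintype.card_fin, Fintype.card_fin, hcard, mul_comm]
    have hconn : (G.comap p).Connected :=
      ((Iso.comap (Equiv.ofBijective p hpb) G).isTree_iff.2 hG).connected
    obtain ⟨h1, h2⟩ := card_coveringChoices_le n (Fintype.card_fin _) hrow hconn.rowGraph
    refine ⟨hle.trans h1, fun h => ?_⟩
    obtain ⟨v, hv, hatt⟩ := h2 (by omega)
    exact hG.nonempty_spiderGraph_iso_of_attached (Fintype.card_fin _) hpb hrow hv hatt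

theorem numMaximumDissociationSets_spiderGraph (n : ℕ) :
    (spiderGraph (Fin n)).numMaximumDissociationSets = 3 ^ n + n + 2 := by
  refine le_antisymm (spiderGraph_isTree.numMaximumDissociationSets_le ?_).1 ?_
  · simp only [Fintype.card_prod, Fintype.card_option, Fintype.card_fin]
    ring
  · have := le_card_coveringChoices_spiderGraph (κ := Fin n)
    rw [Fintype.card_fin] at this
    exact this.trans (card_coveringChoices_le_numMaximumDissociationSets spiderGraph_hasPathRows)

/-! ### The extremal tree as a leaf amalgam of paths -/

/-- The copies of paths glued together in the extremal tree. -/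
def spiderCopy {κ : Type*} : ∀ i : Option κ, Fin (i.elim 3 fun _ => 4) → Option κ × Fin 3
  | none => fun a => (none, a)
  | some j => Fin.cases (none, 0) fun a => (some j, a)

theorem spiderGraph_adj_spiderCopy {κ : Type*} (i : Option κ) (x y : Fin (i.elim 3 fun _ => 4)) :
    (spiderGraph κ).Adj (spiderCopy i x) (spiderCopy i y) ↔
      (pathGraph (i.elim 3 fun _ => 4)).Adj x y := by
  rw [spiderGraph_adj_iff, pathGraph_adj]
  cases i with
  | none =>
    change Fin 3 at x y
    fin_cases x <;> fin_cases y <;> simp [spiderCopy, spiderParent]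
  | some j =>
    have key : ∀ f : Fin 4 → Option κ × Fin 3, f 0 = (none, 0) → f 1 = (some j, 0) →
        f 2 = (some j, 1) → f 3 = (some j, 2) → ∀ x y : Fin 4,
        (f x ≠ (none, 0) ∧ spiderParent (f x) = f y ∨ f y ≠ (none, 0) ∧ spiderParent (f y) = f x ↔
          x.val + 1 = y.val ∨ y.val + 1 = x.val) := by
      intro f h0 h1 h2 h3 x y
      fin_cases x <;> fin_cases y <;> simp [h0, h1, h2, h3, spiderParent]
    exact key (spiderCopy (some j)) rfl rfl rfl rfl x y

theorem spiderCopy_injective {κ : Type*} (i : Option κ) : Function.Injective (spiderCopy i) := by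
  cases i with
  | none => exact fun x y h => congrArg Prod.snd h
  | some j =>
    intro x y h
    change Fin 4 at x y
    cases x using Fin.cases <;> cases y using Fin.cases <;> simp_all [spiderCopy]

theorem isLeaf_pathGraph_zero (n : ℕ) : (pathGraph (n + 2)).IsLeaf 0 := by
  refine ⟨1, pathGraph_adj.2 (.inl (by simp)), fun y hy => Fin.ext ?_⟩
  rcases pathGraph_adj.1 hy with h | h
  · simpa using h.symm
  · simp at h

theorem isLeafAmalgam_of_iso_spiderGraph {κ V : Type*} {G : SimpleGraph V}
    (e : spiderGraph κ ≃g G) :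
    G.IsLeafAmalgam (fun i : Option κ => pathGraph (i.elim 3 fun _ => 4)) := by
  have hmem : ∀ i a, ∃ x, spiderCopy (κ := κ) i x = (i, a) := by
    rintro (_ | j) a
    · exact ⟨a, rfl⟩
    · exact ⟨Fin.succ a, rfl⟩
  have hroot : ∀ i : Option κ, ∃ x, spiderCopy i x = (none, 0) := by
    rintro (_ | j)
    · exact ⟨(0 : Fin 3), rfl⟩
    · exact ⟨(0 : Fin 4), rfl⟩
  have hpar : ∀ u : Option κ × Fin 3, ∃ x, spiderCopy u.1 x = spiderParent u := by
    rintro ⟨i, a⟩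
    fin_cases a
    · exact hroot i
    · exact hmem i 0
    · exact hmem i 1
  refine ⟨e (none, 0), fun i => e.toEmbedding.comp
    ⟨⟨spiderCopy i, spiderCopy_injective i⟩, spiderGraph_adj_spiderCopy i _ _⟩,
    ?_, ?_, ?_, ?_⟩
  · rintro (_ | j)
    · exact ⟨(0 : Fin 3), rfl, isLeaf_pathGraph_zero 1⟩
    · exact ⟨(0 : Fin 4), rfl, isLeaf_pathGraph_zero 2⟩
  · intro i j hij x y h
    have h' : spiderCopy i x = spiderCopy j y := e.injective h
    refine congrArg e (?_ : spiderCopy i x = (none, 0))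
    cases i with
    | none =>
      cases j with
      | none => exact absurd rfl hij
      | some j =>
        change Fin 4 at y
        cases y using Fin.cases with
        | zero => exact h'
        | succ y =>
          have h1 : none = some j := congrArg Prod.fst h'
          cases h1
    | some i =>
      change Fin 4 at x
      cases x using Fin.cases with
      | zero => rfl
      | succ x =>
        exfalso
        cases j with
        | none =>
          have h1 : some i = none := congrArg Prod.fst h'
          cases h1
        | some j =>
          change Fin 4 at y
          cases y using Fin.cases with
          | zero => simp [spiderCopy] at h'
          | succ y =>
            simp only [spiderCopy, Fin.cases_succ, Prod.mk.injEq] at h'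
            exact hij h'.1
  · intro v
    obtain ⟨⟨i, a⟩, rfl⟩ := e.surjective v
    obtain ⟨x, hx⟩ := hmem i a
    exact ⟨i, x, congrArg e hx⟩
  · intro u v huv
    obtain ⟨u, rfl⟩ := e.surjective u
    obtain ⟨v, rfl⟩ := e.surjective v
    rcases spiderGraph_adj_iff.1 (e.map_adj_iff.1 huv) with ⟨-, rfl⟩ | ⟨-, rfl⟩
    · obtain ⟨x, hx⟩ := hmem u.1 u.2
      obtain ⟨y, hy⟩ := hpar u
      exact ⟨u.1, x, y, congrArg e hx, congrArg e hy⟩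
    · obtain ⟨x, hx⟩ := hmem v.1 v.2
      obtain ⟨y, hy⟩ := hpar v
      exact ⟨v.1, y, x, congrArg e hy, congrArg e hx⟩

theorem exists_path_of_isLeaf_pathGraph_three {V : Type*} {G : SimpleGraph V} (φ : pathGraph 3 →g G)
    {x : Fin 3} (hx : (pathGraph 3).IsLeaf x) :
    ∃ q : Fin 3 → V, q 0 = φ x ∧ G.Adj (q 1) (q 0) ∧ G.Adj (q 2) (q 1) ∧ ∀ y, ∃ a, φ y = q a := by
  have hadj : ∀ a b : Fin 3, b.val + 1 = a.val → G.Adj (φ a) (φ b) := fun a b h =>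
    φ.map_adj (pathGraph_adj.2 (.inr h))
  have h10 := hadj 1 0 rfl
  have h21 := hadj 2 1 rfl
  have hx1 : x ≠ 1 := by
    rintro rfl
    have := hx.unique (y₁ := 0) (y₂ := 2) (pathGraph_adj.2 (.inr rfl)) (pathGraph_adj.2 (.inl rfl))
    exact absurd this (by decide)
  by_cases hx0 : x = 0
  · exact ⟨φ, by rw [hx0], h10, h21, fun y => ⟨y, rfl⟩⟩
  · have : x = 2 := by omega
    exact ⟨φ ∘ Fin.rev, by rw [this]; rfl, h21.symm, h10.symm, fun y => ⟨Fin.rev y, by simp⟩⟩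

/-- An inner vertex has two neighbours, so the leaf is an end. Read from that end, the other three
vertices form a row attached to it. -/
theorem exists_path_of_isLeaf_pathGraph_four {V : Type*} {G : SimpleGraph V} (φ : pathGraph 4 →g G)
    {x : Fin 4} (hx : (pathGraph 4).IsLeaf x) :
    ∃ q : Fin 3 → V, G.Adj (q 0) (φ x) ∧ G.Adj (q 1) (q 0) ∧ G.Adj (q 2) (q 1) ∧
      ∀ y, φ y = φ x ∨ ∃ a, φ y = q a := by
  have hadj : ∀ a b : Fin 4, b.val + 1 = a.val → G.Adj (φ a) (φ b) := fun a b h =>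
    φ.map_adj (pathGraph_adj.2 (.inr h))
  have h10 := hadj 1 0 rfl
  have h21 := hadj 2 1 rfl
  have h32 := hadj 3 2 rfl
  have hx1 : x ≠ 1 := by
    rintro rfl
    have := hx.unique (y₁ := 0) (y₂ := 2) (pathGraph_adj.2 (.inr rfl)) (pathGraph_adj.2 (.inl rfl))
    exact absurd this (by decide)
  have hx2 : x ≠ 2 := by
    rintro rfl
    have := hx.unique (y₁ := 1) (y₂ := 3) (pathGraph_adj.2 (.inr rfl)) (pathGraph_adj.2 (.inl rfl))
    exact absurd this (by decide)
  by_cases hx0 : x = 0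
  · subst hx0
    refine ⟨fun a => φ a.succ, h10, h21, h32, fun y => ?_⟩
    cases y using Fin.cases with
    | zero => exact .inl rfl
    | succ a => exact .inr ⟨a, rfl⟩
  · obtain rfl : x = 3 := by omega
    refine ⟨fun a => φ (Fin.rev a.succ), h32.symm, h21.symm, h10.symm, fun y => ?_⟩
    obtain ⟨y, rfl⟩ := Fin.rev_surjective y
    cases y using Fin.cases with
    | zero => exact .inl rfl
    | succ a => exact .inr ⟨a, rfl⟩

theorem IsTree.nonempty_spiderGraph_iso_of_isLeafAmalgam {κ V : Type*} [Fintype κ] [Fintype V]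
    {G : SimpleGraph V} (hG : G.IsTree) (hcard : Fintype.card V = 3 * (Fintype.card κ + 1))
    (h : G.IsLeafAmalgam (fun i : Option κ => pathGraph (i.elim 3 fun _ => 4))) :
    Nonempty (spiderGraph κ ≃g G) := by
  obtain ⟨c, φ, hleaf, -, hcover, -⟩ := h
  obtain ⟨x₀, hx₀, hl₀⟩ := hleaf none
  obtain ⟨q₀, h0, h10, h21, hq₀⟩ := exists_path_of_isLeaf_pathGraph_three (φ none).toHom hl₀
  have hq : ∀ j : κ, ∃ q : Fin 3 → V, G.Adj (q 0) c ∧ G.Adj (q 1) (q 0) ∧ G.Adj (q 2) (q 1) ∧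
      ∀ y, φ (some j) y = c ∨ ∃ a, φ (some j) y = q a := by
    intro j
    obtain ⟨x, hx, hl⟩ := hleaf (some j)
    obtain ⟨q, hq⟩ := exists_path_of_isLeaf_pathGraph_four (φ (some j)).toHom hl
    rw [← hx]
    exact ⟨q, hq⟩
  choose q hqc hq10 hq21 hqcover using hq
  have h0c : q₀ 0 = c := h0.trans hx₀
  let ψ : Option κ × Fin 3 → V := fun x => x.1.elim q₀ q x.2
  refine hG.nonempty_spiderGraph_iso ψ ?_ ?_
  · rw [Fintype.bijective_iff_surjective_and_card]
    constructor
    · intro v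
      obtain ⟨i, y, rfl⟩ := hcover v
      cases i with
      | none =>
        obtain ⟨a, ha⟩ := hq₀ y
        exact ⟨(none, a), ha.symm⟩
      | some j =>
        rcases hqcover j y with h | ⟨a, ha⟩
        · exact ⟨(none, 0), h0c.trans h.symm⟩
        · exact ⟨(some j, a), ha.symm⟩
    · rw [hcard, Fintype.card_prod, Fintype.card_option, Fintype.card_fin, mul_comm]
  · rintro ⟨i, a⟩ hx
    cases i with
    | none =>
      fin_cases a
      · exact absurd rfl hx
      · exact h10
      · exact h21
    | some j =>
      fin_cases a
      · change G.Adj (q j 0) (q₀ 0)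
        rw [h0c]
        exact hqc j
      · exact hq10 j
      · exact hq21 j

end SimpleGraph

theorem theorem4p5 (m : ℕ) (hm : 1 ≤ m) :
    (∀ {V : Type*} [Fintype V] (G : SimpleGraph V), G.IsTree → Fintype.card V = 3 * m →
      G.numMaximumDissociationSets ≤ 3 ^ (m - 1) + m + 1 ∧
      (G.numMaximumDissociationSets = 3 ^ (m - 1) + m + 1 ↔
        -- one copy of `P_3` (index `none`) and `m - 1` copies of `P_4`
        G.IsLeafAmalgam (fun i : Option (Fin (m - 1)) =>
          SimpleGraph.pathGraph (i.elim 3 (fun _ => 4))))) ∧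
    (∃ G : SimpleGraph (Fin (3 * m)), G.IsTree ∧
      G.numMaximumDissociationSets = 3 ^ (m - 1) + m + 1) := by
  obtain ⟨n, rfl⟩ : ∃ n, m = n + 1 := ⟨m - 1, by omega⟩
  rw [Nat.add_sub_cancel, show 3 ^ n + (n + 1) + 1 = 3 ^ n + n + 2 by ring]
  constructor
  · intro V _ G hG hcard
    obtain ⟨hle, heq⟩ := hG.numMaximumDissociationSets_le hcard
    refine ⟨hle, fun h => ?_, fun h => ?_⟩
    · obtain ⟨e⟩ := heq h
      exact SimpleGraph.isLeafAmalgam_of_iso_spiderGraph e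
    · obtain ⟨e⟩ := hG.nonempty_spiderGraph_iso_of_isLeafAmalgam (by simpa using hcard) h
      rw [← SimpleGraph.numMaximumDissociationSets_congr e,
        SimpleGraph.numMaximumDissociationSets_spiderGraph]
  · have hc : Fintype.card (Option (Fin n) × Fin 3) = 3 * (n + 1) := by
      rw [Fintype.card_prod, Fintype.card_option, Fintype.card_fin, Fintype.card_fin, mul_comm]
    let e := SimpleGraph.Iso.comap (Fintype.equivFinOfCardEq hc).symm
      (SimpleGraph.spiderGraph (Fin n))
    exact ⟨_, e.isTree_iff.2 SimpleGraph.spiderGraph_isTree,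
      (SimpleGraph.numMaximumDissociationSets_congr e).trans
        (SimpleGraph.numMaximumDissociationSets_spiderGraph n)⟩
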